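/- All spaces are Hausdorff. Let $X$ be a topological space. A transfinite sequence $\langle x_\alpha:\alpha<\kappa\rangle$ of points of $X$, where $\kappa$ is an infinite regular cardinal, converges to $p\in X$ if $|\{\alpha<\kappa : x_\alpha\notin U\}|<\kappa$ for every neighborhood $U$ of $p$. A set $A\subseteq X$ is radially closed if no such sequence of points of $A$ converges to a point of $X\setminus A$; the radial closure of $A$ is the smallest radially closed set containing $A$. The space $X$ is pseudoradial if the radial closure of every subset of $X$ is closed, and weakly pseudoradial if the radial closure of every countable subset of $X$ is closed. Let $\mathfrak{pse}$ be the least cardinal $\kappa$ such that the Cantor cube $2^\kappa$ is not pseudoradial, and let $\mathfrak{s}$ be the splitting number, i.e. the least cardinality of a family $\mathcal S\subseteq\mathcal P(\omega)$ such that for every infinite $A\subseteq\omega$ there is $B\in\mathcal S$ with both $A\cap B$ and $A\setminus B$ infinite. Theorem. (1) Suppose $\mathfrak{pse}\le\aleph_2$. Let $X$ be a compact Hausdorff weakly pseudoradial space. Then $X$ is pseudoradial if and only if there is no continuous surjection from $X$ onto $[0,1]^{\mathfrak{pse}}$. (2) If $\mathfrak s\le\aleph_2$, then $\mathfrak{pse}=\mathfrak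 s$. -/

import Mathlib

open Cardinal Topology

universe u

/-- A sequence `(x α)_{α < κ}` converges to `p` if each neighbourhood of `p` leaves out fewer
than `κ` many members (indices) of the sequence. -/
def TransfiniteConverges {X : Type u} [TopologicalSpace X] (κ : Cardinal.{u})
    (x : κ.ord.ToType → X) (p : X) : Prop :=
  ∀ U ∈ 𝓝 p, #{α : κ.ord.ToType // x α ∉ U} < κ

/-- `A` is radially closed if no transfinite sequence in `A`, of infinite regular length,
converges to a point outside `A`. -/
def IsRadiallyClosed {X : Type u} [TopologicalSpace X] (A : Set X) : Prop :=
  ∀ κ : Cardinal.{u}, κ.IsRegular → ∀ x : κ.ord.ToType → X, (∀ α, x α ∈ A) →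
    ∀ p : X, TransfiniteConverges κ x p → p ∈ A

/-- The radial closure of `A`: the smallest radially closed set containing `A`. -/
def radialClosure {X : Type u} [TopologicalSpace X] (A : Set X) : Set X :=
  ⋂₀ {B : Set X | A ⊆ B ∧ IsRadiallyClosed B}

/-- The radial closure really is the least radially closed superset. -/
theorem isLeast_radialClosure {X : Type u} [TopologicalSpace X] (A : Set X) :
    IsLeast {B : Set X | A ⊆ B ∧ IsRadiallyClosed B} (radialClosure A) :=
  ⟨⟨Set.subset_sInter fun _ hB => hB.1, fun κ hκ x hx p hp B hB =>
      hB.2 κ hκ x (fun α => hx α B hB) p hp⟩,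
    fun _ hB => Set.sInter_subset_of_mem hB⟩

/-- A space is pseudoradial if the radial closure of every subset is closed. -/
def IsPseudoradial (X : Type u) [TopologicalSpace X] : Prop :=
  ∀ A : Set X, IsClosed (radialClosure A)

/-- A space is weakly pseudoradial if the radial closure of every countable subset is closed. -/
def IsWeaklyPseudoradial (X : Type u) [TopologicalSpace X] : Prop :=
  ∀ A : Set X, A.Countable → IsClosed (radialClosure A)

/-- The pseudoradial number: the least `κ` such that the Cantor cube `2^κ`
(product topology, discrete factors) is not pseudoradial. -/
noncomputable def pseudoradialNumber : Cardinal.{0} :=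
  sInf {κ : Cardinal.{0} | ¬ IsPseudoradial (κ.ord.ToType → Bool)}

/-- A family `S` of subsets of `ℕ` is splitting if each infinite `A ⊆ ℕ` is split by some
member `B` of `S`, i.e. both `A ∩ B` and `A \ B` are infinite. -/
def IsSplittingFamily (S : Set (Set ℕ)) : Prop :=
  ∀ A : Set ℕ, A.Infinite → ∃ B ∈ S, (A ∩ B).Infinite ∧ (A \ B).Infinite

/-- The splitting number: the least cardinality of a splitting family. -/
noncomputable def splittingNumber : Cardinal.{0} :=
  sInf {κ : Cardinal.{0} | ∃ S : Set (Set ℕ), IsSplittingFamily S ∧ #S = κ}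

/-! # Compact pseudoradial spaces and the pseudoradial number -/

/-! ### Radially closed sets -/

/-! Part (2). The points of a Cantor cube whose coordinates are indicators of a splitting family
form an infinite set without nontrivial convergent sequences. All its subsets are radially closed,
yet it has an accumulation point; so `𝔭𝔰𝔢 ≤ 𝔰`. Below `𝔰` cubes are sequentially compact, so a
radially closed set agrees with any point `p` of its closure on each countable set of coordinates.
For weight `ℵ₁` this yields an `ω₁`-sequence converging to `p`.

Part (1). A surjection onto `[0,1]^𝔭𝔰𝔢` pulls a bad subset of the Cantor subcube back to a bad
subset of `X` (`IsPseudoradial.not_surjective_cube`). Conversely, let `A` be radially closed and not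
closed; weak pseudoradiality puts closures of countable subsets of `A` inside `A`. Take a family of
continuous functions of least size `θ` whose common zeros meet the closure of `A` in a nonempty set
`K` missing `A`. Both `θ` and its cofinality are uncountable. If countably many nonempty sets cut
out of the closure of `A` by at most `θ` functions entered all neighbourhoods of a point of `K`, a
sequence in `A` of length `cof θ` would converge to that point (`IsZeroDense.mem_of_forall_nhds`),
which is absurd. This absence of countable local networks drives a recursion of length `ω₂`
(`exists_isIndependentStep`) that produces functions on `K`, each independent of its predecessors
below a finite condition. Pressing down fixes the condition on `ℵ₂` indices, and the resulting
independent family maps `X` onto `[0,1]^ℵ₂`, hence onto `[0,1]^𝔭𝔰𝔢`. -/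

theorem radialClosure_eq_self {X : Type u} [TopologicalSpace X] {A : Set X}
    (hA : IsRadiallyClosed A) : radialClosure A = A :=
  ((isLeast_radialClosure A).2 ⟨subset_rfl, hA⟩).antisymm (isLeast_radialClosure A).1.1

theorem isPseudoradial_iff {X : Type u} [TopologicalSpace X] :
    IsPseudoradial X ↔ ∀ A : Set X, IsRadiallyClosed A → IsClosed A :=
  ⟨fun h A hA => radialClosure_eq_self hA ▸ h A, fun h A => h _ (isLeast_radialClosure A).1.2⟩

/-- Transfinite sequences may be indexed by any type of infinite regular cardinality. -/
theorem IsRadiallyClosed.mem_of_forall_mk_lt {X : Type u} [TopologicalSpace X] {A : Set X}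
    (hA : IsRadiallyClosed A) {ι : Type u} (hι : (#ι).IsRegular) (x : ι → X) (hx : ∀ i, x i ∈ A)
    {p : X} (hp : ∀ U ∈ 𝓝 p, #{i // x i ∉ U} < #ι) : p ∈ A := by
  obtain ⟨e⟩ : Nonempty ((#ι).ord.ToType ≃ ι) := Cardinal.eq.1 (mk_ord_toType _)
  refine hA (#ι) hι (x ∘ e) (fun α => hx _) p fun U hU => ?_
  refine lt_of_eq_of_lt (Cardinal.mk_congr ?_) (hp U hU)
  exact e.subtypeEquiv fun a => Iff.rfl

theorem IsRadiallyClosed.mem_of_tendsto_seq {X : Type u} [TopologicalSpace X] {A : Set X}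
    (hA : IsRadiallyClosed A) {x : ℕ → X} (hx : ∀ n, x n ∈ A) {p : X}
    (hp : Filter.Tendsto x Filter.atTop (𝓝 p)) : p ∈ A := by
  refine hA.mem_of_forall_mk_lt (ι := ULift.{u} ℕ) (by simpa using isRegular_aleph0)
    (fun i => x i.down) (fun i => hx _) fun U hU => ?_
  have h1 : {n | x n ∉ U}.Finite := by
    have := hp.eventually hU
    rw [← Nat.cofinite_eq_atTop] at this
    exact this
  have h2 : {i : ULift.{u} ℕ | x i.down ∉ U}.Finite :=
    h1.preimage ULift.down_injective.injOn
  simpa using (Cardinal.lt_aleph0_iff_set_finite.2 h2)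

/-- A long sequence with a fibre of full size can only converge to the value on that fibre. -/
theorem TransfiniteConverges.eq_of_le_mk_fiber {X : Type u} [TopologicalSpace X] [T1Space X]
    {κ : Cardinal.{u}} {x : κ.ord.ToType → X} {p q : X} (hp : TransfiniteConverges κ x p)
    (hq : κ ≤ #{α // x α = q}) : p = q := by
  by_contra hpq
  refine (hp {q}ᶜ (isOpen_compl_singleton.mem_nhds hpq)).not_ge (hq.trans ?_)
  simp

/-- Radially closed sets in a small space are closed under limits of sequences whose length lives
in a larger universe. -/
theorem IsRadiallyClosed.mem_of_forall_mk_lt_lift {Y : Type} [TopologicalSpace Y] [T1Space Y]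
    {B : Set Y} (hB : IsRadiallyClosed B) {κ : Cardinal.{u}} (hκ : κ.IsRegular)
    (y : κ.ord.ToType → Y) (hy : ∀ α, y α ∈ B) {b : Y}
    (hb : ∀ U ∈ 𝓝 b, #{α // y α ∉ U} < κ) : b ∈ B := by
  rcases le_or_gt κ (Cardinal.lift.{u} #Y) with h | h
  · obtain ⟨κ', rfl⟩ := Cardinal.mem_range_lift_of_le h
    obtain ⟨e⟩ : Nonempty (ULift.{u} κ'.ord.ToType ≃ (Cardinal.lift.{u} κ').ord.ToType) := by
      apply Cardinal.eq.1
      simp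
    refine hB κ' (isRegular_lift_iff.1 hκ) (fun α => y (e ⟨α⟩)) (fun α => hy _) b fun U hU => ?_
    have := hb U hU
    rw [← Cardinal.lift_lt.{0, u}]
    refine lt_of_eq_of_lt ?_ this
    rw [← Cardinal.mk_uLift]
    refine Cardinal.mk_congr ?_
    refine Equiv.ulift.trans ((Equiv.ulift.symm.trans e).subtypeEquiv fun a => Iff.rfl)
  -- A length exceeding the size of the space forces a fibre of full size, so the limit is the value
  -- on that fibre.
  · obtain ⟨a, ha⟩ := infinite_pigeonhole_card (fun α => ULift.up.{u} (y α)) κ (by simp)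
      hκ.aleph0_le (by rw [hκ.cof_ord, Cardinal.mk_uLift]; exact h)
    have hne : Nonempty ((fun α => ULift.up.{u} (y α)) ⁻¹' {a}) := by
      rw [← Cardinal.mk_ne_zero_iff]
      exact (hκ.pos.trans_le ha).ne'
    obtain ⟨α, hα⟩ := hne
    have hα' : y α = a.down := by simpa using congrArg ULift.down hα
    by_contra hbB
    have hne : b ≠ a.down := by
      rintro rfl
      exact hbB (hα' ▸ hy α)
    refine (hb {a.down}ᶜ (isOpen_compl_singleton.mem_nhds hne)).not_ge (ha.trans ?_)
    refine Cardinal.mk_le_of_injective (f := fun i => ⟨i.1, ?_⟩) ?_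
    · have := i.2
      simpa using congrArg ULift.down this
    · intro i j hij
      simpa [Subtype.ext_iff] using hij

/-! ### Cantor cubes and splitting families -/

theorem exists_isSplittingFamily_mk_eq :
    ∃ S : Set (Set ℕ), IsSplittingFamily S ∧ #S = splittingNumber := by
  refine csInf_mem (s := {κ : Cardinal.{0} | ∃ S : Set (Set ℕ), IsSplittingFamily S ∧ #S = κ})
    ⟨_, Set.univ, fun A hA => ?_, rfl⟩
  -- Every other element of `A`, in increasing order.
  refine ⟨Nat.nth (· ∈ A) '' {n | Even n}, Set.mem_univ _, ?_, ?_⟩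
  · have : (Nat.nth (· ∈ A) '' {n | Even n}).Infinite :=
      (Nat.frequently_atTop_iff_infinite.1 Nat.frequently_even).image
        (Nat.nth_injective hA).injOn
    refine this.mono fun x hx => ⟨?_, hx⟩
    obtain ⟨n, -, rfl⟩ := hx
    exact Nat.nth_mem_of_infinite hA n
  · have : (Nat.nth (· ∈ A) '' {n | Odd n}).Infinite :=
      (Nat.frequently_atTop_iff_infinite.1 Nat.frequently_odd).image
        (Nat.nth_injective hA).injOn
    refine this.mono ?_
    rintro _ ⟨n, hn, rfl⟩
    refine ⟨Nat.nth_mem_of_infinite hA n, ?_⟩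
    rintro ⟨m, hm, hmn⟩
    rw [Nat.nth_injective hA hmn] at hm
    exact Nat.not_even_iff_odd.2 hn hm

/-- The cube indexed by a splitting family is not pseudoradial. -/
theorem not_isPseudoradial_of_isSplittingFamily {I : Type} {B : I → Set ℕ}
    (hB : IsSplittingFamily (Set.range B)) : ¬ IsPseudoradial (I → Bool) := by
  classical
  rw [isPseudoradial_iff]
  intro hps
  set x : ℕ → I → Bool := fun n i => decide (n ∈ B i) with hx
  -- no infinite set of indices gives a pointwise convergent subsequence
  have hsplit : ∀ N : Set ℕ, N.Infinite → ∃ i, {n ∈ N | x n i = true}.Infinite ∧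
      {n ∈ N | x n i = false}.Infinite := by
    intro N hN
    obtain ⟨_, ⟨i, rfl⟩, h1, h2⟩ := hB N hN
    refine ⟨i, h1.mono fun n hn => ⟨hn.1, by simpa [hx] using hn.2⟩,
      h2.mono fun n hn => ⟨hn.1, by simpa [hx] using hn.2⟩⟩
  have hrad : ∀ A ⊆ Set.range x, IsRadiallyClosed A := by
    intro A hA κ hκ y hy p hp
    choose n hn using fun α => hA (hy α)
    by_cases hfib : ∃ m, κ ≤ #{α // n α = m}
    · obtain ⟨m, hm⟩ := hfib
      have hne : Nonempty {α // n α = m} := by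
        rw [← Cardinal.mk_ne_zero_iff]
        exact (hκ.pos.trans_le hm).ne'
      obtain ⟨α, hα⟩ := hne
      have : p = x m := hp.eq_of_le_mk_fiber (hm.trans (Cardinal.mk_subtype_mono fun β hβ => by
        rw [← hn β, hβ]))
      rw [this, ← hα, hn α]
      exact hy α
    · exfalso
      push Not at hfib
      -- The values have countably many labels `n α`, so a sequence of uncountable regular length
      -- would have a full fibre.
      have hκ0 : κ = ℵ₀ := by
        by_contra h0
        have h1 : ℵ₀ < κ := lt_of_le_of_ne hκ.aleph0_le (Ne.symm h0)
        obtain ⟨m, hm⟩ := infinite_pigeonhole_card n κ (by simp) hκ.aleph0_le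
          (by simpa [hκ.cof_ord] using h1)
        exact (hfib m).not_ge hm
      subst hκ0
      have hinf : (Set.range n).Infinite := by
        intro hfin
        have : Finite (Set.range n) := hfin
        obtain ⟨m, hm⟩ := infinite_pigeonhole_card (Set.rangeFactorization n) ℵ₀ (by simp) le_rfl
          (by simp)
        refine (hfib m.1).not_ge (hm.trans ?_)
        exact Cardinal.mk_subtype_mono fun α hα => congrArg Subtype.val hα
      obtain ⟨i, h1, h2⟩ := hsplit _ hinf
      have key : {m ∈ Set.range n | x m i ≠ p i}.Infinite := by
        cases hpi : p i
        · exact h1.mono fun m hm => ⟨hm.1, by simp [hm.2]⟩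
        · exact h2.mono fun m hm => ⟨hm.1, by simp [hm.2]⟩
      have hU := hp {z | z i = p i} (((continuous_apply i).continuousAt (x := p)).preimage_mem_nhds
        (isOpen_discrete ({p i} : Set Bool) |>.mem_nhds rfl))
      have hfin : {α | y α ∉ {z : I → Bool | z i = p i}}.Finite := lt_aleph0_iff_set_finite.1 hU
      refine key ((hfin.image n).subset ?_)
      rintro _ ⟨⟨α, rfl⟩, hα⟩
      exact ⟨α, by simpa [← hn α] using hα, rfl⟩
  have hinf : (Set.range x).Infinite := by
    intro hfin
    have : Finite (Set.range x) := hfin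
    obtain ⟨q, hq⟩ := Finite.exists_infinite_fiber (Set.rangeFactorization x)
    obtain ⟨i, h1, h2⟩ := hsplit _ (Set.infinite_coe_iff.1 hq)
    obtain ⟨m, hm, hm'⟩ := h1.nonempty
    obtain ⟨l, hl, hl'⟩ := h2.nonempty
    have e1 : x m = q := congrArg Subtype.val hm
    have e2 : x l = q := congrArg Subtype.val hl
    rw [e1, ← e2, hl'] at hm'
    exact absurd hm' (by simp)
  obtain ⟨p, -, hp⟩ := hinf.exists_accPt_of_subset_isCompact isCompact_univ (Set.subset_univ _)
  have hcl := hps (Set.range x \ {p}) (hrad _ Set.sdiff_subset)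
  have : p ∈ closure (Set.range x \ {p}) := by
    rw [accPt_iff_clusterPt, inf_comm, Filter.inf_principal] at hp
    exact mem_closure_iff_clusterPt.2 hp
  rw [hcl.closure_eq] at this
  exact this.2 rfl

theorem not_isPseudoradial_cube_splittingNumber :
    ¬ IsPseudoradial (splittingNumber.ord.ToType → Bool) := by
  obtain ⟨S, hS, hS'⟩ := exists_isSplittingFamily_mk_eq
  obtain ⟨e⟩ : Nonempty (splittingNumber.ord.ToType ≃ S) := Cardinal.eq.1 (by simp [hS'])
  refine not_isPseudoradial_of_isSplittingFamily (B := fun i => (e i : Set ℕ)) ?_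
  convert hS
  ext s
  exact ⟨fun ⟨i, hi⟩ => hi ▸ (e i).2, fun hs => ⟨e.symm ⟨s, hs⟩, by simp⟩⟩

theorem not_isPseudoradial_cube_pseudoradialNumber :
    ¬ IsPseudoradial (pseudoradialNumber.ord.ToType → Bool) :=
  csInf_mem (s := {κ : Cardinal.{0} | ¬ IsPseudoradial (κ.ord.ToType → Bool)})
    ⟨_, not_isPseudoradial_cube_splittingNumber⟩

theorem pseudoradialNumber_le_splittingNumber : pseudoradialNumber ≤ splittingNumber :=
  csInf_le' not_isPseudoradial_cube_splittingNumber

/-- Cantor cubes of weight below the splitting number are sequentially compact. -/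
theorem exists_tendsto_subseq_of_lt_splittingNumber {I : Type} (hI : #I < splittingNumber)
    (x : ℕ → I → Bool) :
    ∃ (p : I → Bool) (φ : ℕ → ℕ), StrictMono φ ∧
      Filter.Tendsto (x ∘ φ) Filter.atTop (𝓝 p) := by
  -- These sets are too few to split every infinite set; along an unsplit `N` each coordinate is
  -- eventually constant.
  have hns : ¬ IsSplittingFamily (Set.range fun i => {n | x n i = true}) := fun h =>
    (csInf_le' ⟨_, h, rfl⟩ : splittingNumber ≤ _).not_gt (mk_range_le.trans_lt hI)
  simp only [IsSplittingFamily, not_forall, Set.exists_range_iff, not_exists, not_and,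
    Set.not_infinite] at hns
  obtain ⟨N, hN, h⟩ := hns
  have hconv : ∀ i, ∃ b, ∀ᶠ k in Filter.atTop, x (Nat.nth (· ∈ N) k) i = b := by
    intro i
    have aux : ∀ s : Set ℕ, s.Finite → ∀ᶠ k in Filter.atTop, Nat.nth (· ∈ N) k ∉ s := by
      intro s hs
      rw [← Nat.cofinite_eq_atTop, Filter.eventually_cofinite]
      exact (hs.preimage (Nat.nth_injective hN).injOn).subset fun k hk => not_not.1 hk
    by_cases hi : (N ∩ {n | x n i = true}).Infinite
    · refine ⟨true, (aux _ (h i hi)).mono fun k hk => ?_⟩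
      by_contra hc
      exact hk ⟨Nat.nth_mem_of_infinite hN k, hc⟩
    · refine ⟨false, (aux _ (Set.not_infinite.1 hi)).mono fun k hk => ?_⟩
      by_contra hc
      exact hk ⟨Nat.nth_mem_of_infinite hN k, by simpa using hc⟩
  choose p hp using hconv
  refine ⟨p, Nat.nth (· ∈ N), Nat.nth_strictMono hN, tendsto_pi_nhds.2 fun i => ?_⟩
  exact tendsto_const_nhds.congr' ((hp i).mono fun k hk => hk.symm)

/-- Points of `A` agreeing with `p` on longer and longer finite parts of `D` have a convergent
subsequence, whose limit stays in `A`. -/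
theorem exists_mem_eqOn_of_countable {I : Type} (hI : #I < splittingNumber) {A : Set (I → Bool)}
    (hA : IsRadiallyClosed A) {p : I → Bool} (hp : p ∈ closure A) {D : Set I}
    (hD : D.Countable) : ∃ a ∈ A, Set.EqOn a p D := by
  rcases D.eq_empty_or_nonempty with rfl | hne
  · obtain ⟨a, ha⟩ := closure_nonempty_iff.1 ⟨p, hp⟩
    exact ⟨a, ha, Set.eqOn_empty _ _⟩
  obtain ⟨d, rfl⟩ := hD.exists_eq_range hne
  have hx : ∀ n : ℕ, ∃ a ∈ A, ∀ k ≤ n, a (d k) = p (d k) := by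
    intro n
    have hopen : IsOpen {z : I → Bool | ∀ k ∈ Finset.range (n + 1), z (d k) = p (d k)} := by
      simp only [Set.ofPred_forall]
      refine isOpen_biInter_finset fun k _ => ?_
      exact (isOpen_discrete ({p (d k)} : Set Bool)).preimage
        (continuous_apply (A := fun _ : I => Bool) (d k))
    obtain ⟨a, ha, haA⟩ := mem_closure_iff.1 hp _ hopen (fun _ _ => rfl)
    exact ⟨a, haA, fun k hk => ha k (by simpa [Nat.lt_succ_iff] using hk)⟩
  choose x hxA hx using hx
  obtain ⟨a, φ, hφ, hlim⟩ := exists_tendsto_subseq_of_lt_splittingNumber hI x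
  refine ⟨a, hA.mem_of_tendsto_seq (fun n => hxA (φ n)) hlim, ?_⟩
  rintro _ ⟨k, rfl⟩
  have h1 := (tendsto_pi_nhds.1 hlim (d k))
  refine tendsto_nhds_unique h1 (tendsto_const_nhds.congr' ?_)
  filter_upwards [Filter.eventually_ge_atTop k] with n hn
  exact (hx (φ n) k (hn.trans (hφ.id_le n))).symm

theorem isPseudoradial_cube_of_lt_splittingNumber {κ : Cardinal.{0}} (hκ : κ < splittingNumber)
    (hκ1 : κ ≤ ℵ₁) : IsPseudoradial (κ.ord.ToType → Bool) := by
  rw [isPseudoradial_iff]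
  intro A hA
  refine isClosed_of_closure_subset fun p hp => ?_
  have hI : #κ.ord.ToType < splittingNumber := by simpa using hκ
  rcases hκ1.lt_or_eq with h | rfl
  · have : Countable κ.ord.ToType := by
      rw [← Cardinal.mk_le_aleph0_iff]
      simpa [← Cardinal.lt_aleph_one_iff] using h
    obtain ⟨a, ha, hap⟩ := exists_mem_eqOn_of_countable hI hA hp (Set.to_countable Set.univ)
    rwa [← Set.eqOn_univ _ _ |>.1 hap]
  · have hcount : ∀ i : (ℵ₁ : Cardinal.{0}).ord.ToType, (Set.Iic i).Countable := by
      intro i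
      rw [← Set.Iio_insert]
      refine Set.Countable.insert _ ?_
      rw [← Cardinal.le_aleph0_iff_set_countable, ← Cardinal.lt_aleph_one_iff]
      simpa using mk_Iio_lt i
    -- The point `a i` agrees with `p` up to `i`, so each coordinate is correct from its own index
    -- onwards.
    choose a haA ha using fun i => exists_mem_eqOn_of_countable hI hA hp (hcount i)
    refine hA ℵ₁ isRegular_aleph_one a haA p fun U hU => ?_
    rw [nhds_pi, Filter.mem_pi] at hU
    obtain ⟨F, hF, t, ht, hFU⟩ := hU
    have hlt : (⋃ i ∈ F, Set.Iio i).Countable :=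
      hF.countable.biUnion fun i _ => (hcount i).mono Set.Iio_subset_Iic_self
    refine lt_of_le_of_lt ?_ (Cardinal.lt_aleph_one_iff.2
      (Cardinal.le_aleph0_iff_set_countable.2 hlt))
    refine Cardinal.mk_subtype_mono fun α hα => ?_
    by_contra hc
    simp only [Set.mem_iUnion, Set.mem_Iio, not_exists, not_lt] at hc
    refine hα (hFU fun i hi => ?_)
    rw [ha α (hc i hi)]
    exact mem_of_mem_nhds (ht i)

theorem aleph_two_eq_succ : (ℵ_ 2 : Cardinal.{u}) = Order.succ ℵ₁ := by
  rw [Cardinal.succ_aleph, one_add_one_eq_two]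

theorem pseudoradialNumber_eq_splittingNumber (h : splittingNumber ≤ ℵ_ 2) :
    pseudoradialNumber = splittingNumber := by
  refine pseudoradialNumber_le_splittingNumber.antisymm ?_
  by_contra! hlt
  refine not_isPseudoradial_cube_pseudoradialNumber
    (isPseudoradial_cube_of_lt_splittingNumber hlt ?_)
  rw [aleph_two_eq_succ] at h
  exact Order.lt_succ_iff.1 (hlt.trans_le h)

/-! ### Zero sets and long convergent sequences -/

theorem mk_Iic_toType_lt {θ : Cardinal.{u}} (hθ : ℵ₀ ≤ θ) (i : θ.ord.ToType) :
    #(Set.Iic i) < θ := by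
  rw [← Set.Iio_insert]
  refine mk_insert_le.trans_lt (add_lt_of_lt hθ ?_ (one_lt_aleph0.trans_le hθ))
  simpa using mk_Iio_lt i

/-- The set of common zeros of a family of continuous functions. -/
def commonZeros {X : Type u} [TopologicalSpace X] (H : Set C(X, ℝ)) : Set X :=
  {x | ∀ h ∈ H, h x = 0}

theorem isClosed_commonZeros {X : Type u} [TopologicalSpace X] (H : Set C(X, ℝ)) :
    IsClosed (commonZeros H) := by
  have : commonZeros H = ⋂ h ∈ H, {x | h x = 0} := by
    ext; simp [commonZeros]
  rw [this]
  exact isClosed_biInter fun h _ => isClosed_eq h.continuous continuous_const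

section
variable {X : Type u} [TopologicalSpace X] [CompactSpace X] {A : Set X}

/-- Choose one point of `A` in each `Q n`: by compactness all `Q n` share a point of the closure of
this countable set, and that closure lies in `A`. -/
theorem exists_mem_forall_mem_of_antitone
    (hω : ∀ C ⊆ A, C.Countable → closure C ⊆ A) {Q : ℕ → Set X} (hQ : ∀ n, IsClosed (Q n))
    (hanti : ∀ n, Q (n + 1) ⊆ Q n) (hne : ∀ n, (A ∩ Q n).Nonempty) :
    ∃ x ∈ A, ∀ n, x ∈ Q n := by
  choose a haA haQ using hne
  have hmono : Antitone Q := antitone_nat_of_succ_le hanti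
  have key := IsCompact.nonempty_iInter_of_sequence_nonempty_isCompact_isClosed
    (fun n => closure (Set.range a) ∩ Q n)
    (fun n => Set.inter_subset_inter_right _ (hanti n))
    (fun n => ⟨a n, subset_closure ⟨n, rfl⟩, haQ n⟩)
    (isClosed_closure.inter (hQ 0)).isCompact
    (fun n => isClosed_closure.inter (hQ n))
  obtain ⟨x, hx⟩ := key
  rw [Set.mem_iInter] at hx
  exact ⟨x, hω _ (Set.range_subset_iff.2 haA) (Set.countable_range a) (hx 0).1, fun n => (hx n).2⟩

theorem nonempty_inter_commonZeros_of_countable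
    (hω : ∀ C ⊆ A, C.Countable → closure C ⊆ A) {H : Set C(X, ℝ)} (hH : H.Countable)
    (hne : (closure A ∩ commonZeros H).Nonempty) : (A ∩ commonZeros H).Nonempty := by
  obtain ⟨p, hp, hpH⟩ := hne
  rcases H.eq_empty_or_nonempty with rfl | hHne
  · obtain ⟨a, ha⟩ := closure_nonempty_iff.1 ⟨p, hp⟩
    exact ⟨a, ha, by simp [commonZeros]⟩
  obtain ⟨h, rfl⟩ := hH.exists_eq_range hHne
  have key := exists_mem_forall_mem_of_antitone hω
    (Q := fun n : ℕ => {x | ∀ k ∈ Finset.range (n + 1), |h k x| ≤ 1 / ((n : ℝ) + 1)})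
  refine (key ?_ ?_ ?_).elim fun x ⟨hxA, hx⟩ => ?_
  pick_goal 4
  · refine ⟨x, hxA, ?_⟩
    rintro _ ⟨k, rfl⟩
    by_contra hc
    obtain ⟨n, hn⟩ := exists_nat_one_div_lt (abs_pos.2 hc)
    -- The index must be at least `k` for `h k` to be constrained, and at least `n` for the bound to
    -- be small.
    have h1 := hx (max n k) k (by simp)
    have h2 : 1 / (((max n k : ℕ) : ℝ) + 1) ≤ 1 / ((n : ℝ) + 1) := by
      apply one_div_le_one_div_of_le (by positivity)
      have : (n : ℝ) ≤ ((max n k : ℕ) : ℝ) := by exact_mod_cast le_max_left n k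
      linarith
    linarith
  · intro n
    simp only [Set.ofPred_forall]
    exact isClosed_biInter fun k _ =>
      isClosed_le (continuous_abs.comp (h k).continuous) continuous_const
  · intro n x hx k hk
    refine (hx k (by simp at hk ⊢; omega)).trans ?_
    apply one_div_le_one_div_of_le (by positivity)
    push_cast
    linarith
  · intro n
    have hopen : IsOpen {x | ∀ k ∈ Finset.range (n + 1), |h k x| < 1 / ((n : ℝ) + 1)} := by
      simp only [Set.ofPred_forall]
      exact isOpen_biInter_finset fun k _ =>
        isOpen_lt (continuous_abs.comp (h k).continuous) continuous_const
    obtain ⟨a, ha, haA⟩ := mem_closure_iff.1 hp _ hopen fun k _ => by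
      rw [hpH _ ⟨k, rfl⟩]
      simp only [abs_zero]
      positivity
    exact ⟨a, haA, fun k hk => (ha k hk).le⟩

/-- Closed sets cut out by fewer than `θ` functions meet `A` whenever they meet its closure. -/
def IsZeroDense (A : Set X) (θ : Cardinal.{u}) : Prop :=
  ∀ H : Set C(X, ℝ), #H < θ → (closure A ∩ commonZeros H).Nonempty → (A ∩ commonZeros H).Nonempty

/-- A family of least cardinality among those whose zeros meet the closure but not `A`. One exists,
since all functions vanishing at `p` together cut out `{p}`. -/
theorem exists_isZeroDense [T2Space X] (hA : ¬ IsClosed A) :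
    ∃ H : Set C(X, ℝ), (closure A ∩ commonZeros H).Nonempty ∧ ¬ (A ∩ commonZeros H).Nonempty ∧
      IsZeroDense A #H := by
  let S : Set Cardinal.{u} := {c | ∃ H : Set C(X, ℝ), #H = c ∧
    (closure A ∩ commonZeros H).Nonempty ∧ ¬ (A ∩ commonZeros H).Nonempty}
  have hS : S.Nonempty := by
    obtain ⟨p, hp, hpA⟩ : ∃ p ∈ closure A, p ∉ A := by
      by_contra! hc
      exact hA (isClosed_of_closure_subset hc)
    refine ⟨_, {h | h p = 0}, rfl, ⟨p, hp, fun h hh => hh⟩, ?_⟩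
    rintro ⟨a, haA, ha⟩
    have hne : a ≠ p := by
      rintro rfl
      exact hpA haA
    obtain ⟨f, hf0, hf1, -⟩ := exists_continuous_zero_one_of_isClosed (isClosed_singleton (x := p))
      (isClosed_singleton (x := a)) (by simpa using hne.symm)
    have h0 : f a = 0 := ha f (hf0 rfl)
    have h1 : f a = 1 := hf1 rfl
    rw [h0] at h1
    exact zero_ne_one h1
  obtain ⟨H, hH, hne, hdisj⟩ := show sInf S ∈ S from csInf_mem hS
  refine ⟨H, hne, hdisj, fun G hG hGne => ?_⟩
  by_contra hc
  exact (csInf_le' (show #G ∈ S from ⟨G, rfl, hGne, hc⟩)).not_gt (hH ▸ hG)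

/-- With countable cofinality, `H` would be an increasing union of countably many smaller families;
the zeros of each meet `A`, hence so would their intersection. -/
theorem IsZeroDense.aleph0_lt_cof (hω : ∀ C ⊆ A, C.Countable → closure C ⊆ A)
    {H : Set C(X, ℝ)} (hne : (closure A ∩ commonZeros H).Nonempty)
    (hdisj : ¬ (A ∩ commonZeros H).Nonempty) (hd : IsZeroDense A #H) :
    ℵ₀ < #H ∧ ℵ₀ < (#H).ord.cof := by
  have h1 : ℵ₀ < #H := by
    by_contra! hc
    exact hdisj (nonempty_inter_commonZeros_of_countable hω
      (Cardinal.le_aleph0_iff_set_countable.1 hc) hne)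
  refine ⟨h1, lt_of_le_of_ne (isRegular_cof (isSuccLimit_ord h1.le)).aleph0_le fun hcof => ?_⟩
  obtain ⟨e⟩ : Nonempty ((#H).ord.ToType ≃ H) := Cardinal.eq.1 (by simp)
  obtain ⟨s, hs, hs'⟩ := Order.exists_cof_eq (#H).ord.ToType
  rw [Ordinal.cof_toType, ← hcof] at hs'
  have hsne : s.Nonempty := by
    rw [← Set.nonempty_coe_sort, ← Cardinal.mk_ne_zero_iff, hs']
    exact aleph0_ne_zero
  obtain ⟨j, rfl⟩ := (Cardinal.le_aleph0_iff_set_countable.1 hs'.le).exists_eq_range hsne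
  have key := exists_mem_forall_mem_of_antitone hω
    (Q := fun n : ℕ => commonZeros {h | ∃ k ≤ n, ∃ i ≤ j k, h = (e i : C(X, ℝ))})
    (fun n => isClosed_commonZeros _)
  refine (key ?_ ?_).elim fun x ⟨hxA, hx⟩ => ?_
  pick_goal 3
  · refine hdisj ⟨x, hxA, fun h hh => ?_⟩
    obtain ⟨_, ⟨k, rfl⟩, hk⟩ := hs (e.symm ⟨h, hh⟩)
    exact hx k h ⟨k, le_rfl, _, hk, by simp⟩
  · rintro n x hx h ⟨k, hk, i, hi⟩
    exact hx h ⟨k, by omega, i, hi⟩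
  · intro n
    have : Nonempty (#H).ord.ToType := ⟨j 0⟩
    obtain ⟨m, hm⟩ := ((Set.finite_Iic n).image j).bddAbove
    refine hd _ ((Cardinal.mk_le_mk_of_subset (t := (fun i => (e i : C(X, ℝ))) '' Set.Iic m)
      ?_).trans_lt (mk_image_le.trans_lt (mk_Iic_toType_lt h1.le m))) ?_
    · rintro _ ⟨k, hk, i, hi, rfl⟩
      exact ⟨i, hi.trans (hm ⟨k, hk, rfl⟩), rfl⟩
    · obtain ⟨p, hp, hpH⟩ := hne
      refine ⟨p, hp, ?_⟩
      rintro _ ⟨k, -, i, -, rfl⟩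
      exact hpH _ (e i).2

/-- For each `n` pick `a n j` in `A` killing the functions `h n i` with `i ≤ j`. For fixed `j`, the
limit `y j` of `a n j` along one ultrafilter on `n` lies in `A`, and the points `y j` converge to
`q` as `j` grows. -/
theorem IsZeroDense.mem_of_forall_nhds [T2Space X] (hA : IsRadiallyClosed A)
    (hω : ∀ C ⊆ A, C.Countable → closure C ⊆ A) {θ : Cardinal.{u}} (hd : IsZeroDense A θ)
    (hθ : ℵ₀ ≤ θ) (hcof : ℵ₀ < θ.ord.cof) (h : ℕ → θ.ord.ToType → C(X, ℝ))
    (hne : ∀ n, (closure A ∩ {x | ∀ i, h n i x = 0}).Nonempty) {q : X}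
    (hq : ∀ U ∈ 𝓝 q, ∃ n, closure A ∩ {x | ∀ i, h n i x = 0} ⊆ U) : q ∈ A := by
  have ha : ∀ n j, ∃ a ∈ A, ∀ i ≤ j, h n i a = 0 := by
    intro n j
    obtain ⟨a, ha, ha'⟩ := hd (h n '' Set.Iic j)
      (mk_image_le.trans_lt (mk_Iic_toType_lt hθ j)) (by
        obtain ⟨p, hp, hp'⟩ := hne n
        refine ⟨p, hp, ?_⟩
        rintro _ ⟨i, -, rfl⟩
        exact hp' i)
    exact ⟨a, ha, fun i hi => ha' _ ⟨i, hi, rfl⟩⟩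
  choose a haA ha using ha
  -- an ultrafilter on `ℕ` containing the indices of the zero sets inside each neighbourhood
  let I : Set X → Set ℕ := fun U => {n | closure A ∩ {x | ∀ i, h n i x = 0} ⊆ U}
  have hImono : Monotone I := fun U V hUV n hn => Set.Subset.trans hn hUV
  let F : Filter ℕ := (𝓝 q).lift' I
  have hF : F.NeBot := (Filter.lift'_neBot_iff hImono).2 fun U hU => hq U hU
  let V : Ultrafilter ℕ := Ultrafilter.of F
  have hV : ∀ U ∈ 𝓝 q, I U ∈ V := fun U hU => Ultrafilter.of_le F (Filter.mem_lift' hU)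
  have hy : ∀ j, ∃ y, Filter.Tendsto (fun n => a n j) V (𝓝 y) := by
    intro j
    obtain ⟨y, -, hy⟩ := isCompact_univ.ultrafilter_le_nhds (V.map fun n => a n j) (by simp)
    exact ⟨y, hy⟩
  choose y hy using hy
  have hyA : ∀ j, y j ∈ A := fun j =>
    hω (Set.range fun n => a n j) (Set.range_subset_iff.2 fun n => haA n j)
      (Set.countable_range _) (mem_closure_of_tendsto (hy j)
        (Filter.Eventually.of_forall fun n => ⟨n, rfl⟩))
  -- tails of the long sequence enter each neighbourhood
  have htail : ∀ U ∈ 𝓝 q, ∃ J, ∀ j, J ≤ j → y j ∈ U := by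
    intro U hU
    obtain ⟨C, hC, hCcl, hCU⟩ := exists_mem_nhds_isClosed_subset hU
    have hNe : Nonempty θ.ord.ToType := by
      rw [← Cardinal.mk_ne_zero_iff]
      simpa using (aleph0_pos.trans_le hθ).ne'
    -- By compactness an initial segment of the functions already confines the zero set to the open
    -- set.
    have hstep : ∀ n ∈ I (interior C), ∃ j, ∀ z ∈ closure A,
        (∀ i ≤ j, h n i z = 0) → z ∈ interior C := by
      intro n hn
      by_contra! hc
      have := IsCompact.nonempty_iInter_of_directed_nonempty_isCompact_isClosed
        (fun j : θ.ord.ToType => (closure A ∩ {z | ∀ i ≤ j, h n i z = 0}) ∩ (interior C)ᶜ)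
        (fun j k => ⟨max j k, fun z hz => ⟨⟨hz.1.1, fun i hi => hz.1.2 i (le_max_of_le_left hi)⟩,
          hz.2⟩, fun z hz => ⟨⟨hz.1.1, fun i hi => hz.1.2 i (le_max_of_le_right hi)⟩, hz.2⟩⟩)
        (fun j => by
          obtain ⟨z, hz, hz', hz''⟩ := hc j
          exact ⟨z, ⟨hz, hz'⟩, hz''⟩)
        (fun j => IsClosed.isCompact ?_) (fun j => ?_)
      · obtain ⟨z, hz⟩ := this
        rw [Set.mem_iInter] at hz
        exact (hz hNe.some).2 (hn ⟨(hz hNe.some).1.1, fun i => (hz i).1.2 i le_rfl⟩)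
      all_goals
        refine (isClosed_closure.inter ?_).inter isOpen_interior.isClosed_compl
        simp only [Set.ofPred_forall]
        exact isClosed_iInter fun i => isClosed_iInter fun _ =>
          isClosed_eq (h n i).continuous continuous_const
    choose! J hJ using hstep
    -- Uncountable cofinality makes the bound uniform in `n`.
    obtain ⟨J₀, hJ₀⟩ : ∃ J₀, ∀ n, J n ≤ J₀ := by
      by_contra! hc
      have hcofin : IsCofinal (Set.range J) := fun j => by
        obtain ⟨n, hn⟩ := hc j
        exact ⟨_, ⟨n, rfl⟩, hn.le⟩
      have := Order.cof_le hcofin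
      rw [Ordinal.cof_toType] at this
      have h2 : #(Set.range J) ≤ ℵ₀ :=
        Cardinal.le_aleph0_iff_set_countable.2 (Set.countable_range J)
      exact (hcof.trans_le (this.trans h2)).false
    refine ⟨J₀, fun j hj => hCU (hCcl.mem_of_tendsto (hy j) ?_)⟩
    have hmem := hV (interior C) (interior_mem_nhds.2 hC)
    filter_upwards [hmem] with n hn
    exact interior_subset (hJ n hn _ (subset_closure (haA n j))
      fun i hi => ha n j i (hi.trans ((hJ₀ n).trans hj)))
  -- Since `θ` may be singular, the sequence is thinned to a cofinal set of order type `cof θ`, a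
  -- regular length.
  obtain ⟨s, hs, hs'⟩ := Ordinal.exists_ord_cof_eq θ.ord.ToType
  rw [Ordinal.cof_toType] at hs'
  have hscard : #s = θ.ord.cof := by
    have := congrArg Ordinal.card hs'
    simpa using this
  refine hA.mem_of_forall_mk_lt (ι := s) ?_ (fun j => y j) (fun j => hyA j) fun U hU => ?_
  · rw [hscard]
    exact isRegular_cof (isSuccLimit_ord hθ)
  · obtain ⟨J, hJ⟩ := htail U hU
    obtain ⟨k, hk, hJk⟩ := hs J
    have hlt : #(Set.Iio (⟨k, hk⟩ : s)) < #s := mk_Iio_lt _ (by rw [hs', hscard])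
    refine lt_of_le_of_lt (Cardinal.mk_subtype_mono fun j hj => ?_) hlt
    by_contra hc
    exact hj (hJ j (hJk.trans (not_lt.1 hc)))

/-- A point all of whose neighbourhoods contain one of countably many given zero sets belongs
to `A`. -/
theorem IsZeroDense.mem_of_forall_nhds_commonZeros [T2Space X] (hA : IsRadiallyClosed A)
    (hω : ∀ C ⊆ A, C.Countable → closure C ⊆ A) {θ : Cardinal.{u}} (hd : IsZeroDense A θ)
    (hθ : ℵ₀ ≤ θ) (hcof : ℵ₀ < θ.ord.cof) (H : ℕ → Set C(X, ℝ)) (hH : ∀ n, #(H n) ≤ θ)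
    (hne : ∀ n, (closure A ∩ commonZeros (H n)).Nonempty) {q : X}
    (hq : ∀ U ∈ 𝓝 q, ∃ n, closure A ∩ commonZeros (H n) ⊆ U) : q ∈ A := by
  have henum : ∀ n, ∃ h : θ.ord.ToType → C(X, ℝ), {x | ∀ i, h i x = 0} = commonZeros (H n) := by
    intro n
    -- Adding the zero function allows an enumeration even of an empty family and leaves the common
    -- zeros unchanged.
    have hle : #(insert 0 (H n) : Set C(X, ℝ)) ≤ #θ.ord.ToType := by
      rw [mk_ord_toType]
      exact mk_insert_le.trans (add_le_of_le hθ (hH n) (one_lt_aleph0.le.trans hθ))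
    obtain ⟨f⟩ := hle
    have : Nonempty (insert 0 (H n) : Set C(X, ℝ)) := ⟨⟨0, Set.mem_insert _ _⟩⟩
    obtain ⟨g, hg⟩ : ∃ g : θ.ord.ToType → (insert 0 (H n) : Set C(X, ℝ)), Function.Surjective g :=
      ⟨Function.invFun f, Function.invFun_surjective f.injective⟩
    refine ⟨fun i => (g i : C(X, ℝ)), ?_⟩
    ext x
    constructor
    · intro hx k hk
      obtain ⟨i, hi⟩ := hg ⟨k, Set.mem_insert_of_mem _ hk⟩
      have : (g i : C(X, ℝ)) x = 0 := hx i
      rwa [hi] at this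
    · intro hx i
      change (g i : C(X, ℝ)) x = 0
      rcases (g i).2 with h0 | hmem
      · rw [h0]; rfl
      · exact hx _ hmem
  choose h hh using henum
  refine hd.mem_of_forall_nhds hA hω hθ hcof h (fun n => ?_) fun U hU => ?_
  · rw [hh]; exact hne n
  · obtain ⟨n, hn⟩ := hq U hU
    exact ⟨n, by rwa [hh]⟩

end

/-! ### Combinatorial preliminaries -/

/-- Transfinite recursion for total functions: `P ξ` sees only values up to `ξ`, so later values may
be arbitrary during the construction. -/
theorem exists_forall_of_wellFounded_step {W E : Type*} [LinearOrder W] [WellFoundedLT W]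
    [Nonempty E] {P : W → (W → E) → Prop}
    (hcongr : ∀ ξ f f', Set.EqOn f f' (Set.Iic ξ) → P ξ f → P ξ f')
    (hstep : ∀ ξ f, (∀ η < ξ, P η f) → ∃ e, P ξ (Function.update f ξ e)) :
    ∃ f, ∀ ξ, P ξ f := by
  classical
  let ext : ∀ ξ : W, (∀ η, η < ξ → E) → W → E := fun ξ ih η =>
    if h : η < ξ then ih η h else Classical.arbitrary E
  let F : ∀ ξ : W, (∀ η, η < ξ → E) → E := fun ξ ih =>
    if h : ∃ e, P ξ (Function.update (ext ξ ih) ξ e) then h.choose else Classical.arbitrary E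
  let f : W → E := (wellFounded_lt (α := W)).fix F
  have hf : ∀ ξ, f ξ = F ξ fun η _ => f η := fun ξ => WellFounded.fix_eq _ F ξ
  refine ⟨f, fun ξ => ?_⟩
  induction ξ using WellFoundedLT.induction with
  | ind ξ ih =>
    have hext : ∀ η < ξ, ext ξ (fun η _ => f η) η = f η := fun η hη => by simp [ext, hη]
    have h : ∃ e, P ξ (Function.update (ext ξ fun η _ => f η) ξ e) := by
      refine hstep ξ _ fun η hη => hcongr η f _ (fun ζ hζ => ?_) (ih η hη)
      exact (hext ζ (lt_of_le_of_lt hζ hη)).symm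
    refine hcongr ξ _ f (fun η hη => ?_) h.choose_spec
    rcases (Set.mem_Iic.1 hη).lt_or_eq with hlt | rfl
    · rw [Function.update_of_ne hlt.ne, hext η hlt]
    · rw [Function.update_self, hf η]
      simp only [F]
      rw [dif_pos h]

/-- A cube with at most continuum many factors is separable. -/
theorem exists_seq_agreeing_on_finsets {W : Type} {V : Set W} (hV : #V ≤ 𝔠) :
    ∃ T : ℕ → W → Bool, ∀ a : Finset W, ↑a ⊆ V → ∀ t : W → Bool, ∃ n, ∀ η ∈ a, T n η = t η := by
  classical
  rw [← Cardinal.mk_real] at hV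
  obtain ⟨j⟩ := hV
  obtain ⟨F, hF⟩ := exists_surjective_nat (Finset (TopologicalSpace.countableBasis ℝ))
  -- With `V` embedded in `ℝ`, these are the indicators of finite unions of basic open sets; such
  -- unions separate the finitely many points to be sent to `true` from those to be sent to `false`.
  refine ⟨fun n η => decide (∃ h : η ∈ V, ∃ B ∈ F n, j ⟨η, h⟩ ∈ B.1), fun a ha t => ?_⟩
  let N : Set ℝ := {r | ∃ η, ∃ h : η ∈ a, t η = false ∧ r = j ⟨η, ha h⟩}
  have hN : IsClosed N := by
    refine Set.Finite.isClosed ((Set.finite_range fun η : a => j ⟨η, ha η.2⟩).subset ?_)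
    rintro _ ⟨η, h, -, rfl⟩
    exact ⟨⟨η, h⟩, rfl⟩
  have hbasis : ∀ η : a, t η = true → ∃ B : TopologicalSpace.countableBasis ℝ,
      j ⟨η, ha η.2⟩ ∈ B.1 ∧ B.1 ⊆ Nᶜ := by
    intro η hη
    obtain ⟨B, hB, h1, h2⟩ := (TopologicalSpace.isBasis_countableBasis
      ℝ).exists_subset_of_mem_open (a := j ⟨η, ha η.2⟩) (u := Nᶜ) (by
        rintro ⟨ζ, hζ, hζt, hζj⟩
        have h3 : (η : W) = ζ := congrArg Subtype.val (j.injective hζj)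
        rw [h3, hζt] at hη
        exact absurd hη (by simp)) hN.isOpen_compl
    exact ⟨⟨B, hB⟩, h1, h2⟩
  obtain ⟨B₀⟩ : Nonempty (TopologicalSpace.countableBasis ℝ) := by
    obtain ⟨B, hB, -⟩ := (TopologicalSpace.isBasis_countableBasis
      ℝ).exists_subset_of_mem_open (Set.mem_univ 0) isOpen_univ
    exact ⟨⟨B, hB⟩⟩
  have hne : Nonempty (TopologicalSpace.countableBasis ℝ) := ⟨B₀⟩
  choose! B hB1 hB2 using hbasis
  obtain ⟨n, hn⟩ := hF ((Finset.univ.filter fun η : a => t η = true).image B)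
  refine ⟨n, fun η hη => ?_⟩
  cases ht : t η
  · rw [decide_eq_false_iff_not]
    rintro ⟨h, C, hC, hjC⟩
    rw [hn, Finset.mem_image] at hC
    obtain ⟨ζ, hζ, rfl⟩ := hC
    exact hB2 ζ (Finset.mem_filter.1 hζ).2 hjC ⟨η, hη, ht, rfl⟩
  · rw [decide_eq_true_iff]
    refine ⟨ha hη, B ⟨η, hη⟩, ?_, hB1 ⟨η, hη⟩ ht⟩
    rw [hn, Finset.mem_image]
    exact ⟨⟨η, hη⟩, by simp [ht], rfl⟩

/-- A pressing-down principle for functions to finite sets. -/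
theorem exists_mk_fiber_eq_of_regressive {κ : Cardinal.{0}} (hκ : κ.IsRegular) (hκ0 : ℵ₀ < κ)
    {E : Type} [Countable E] (c : κ.ord.ToType → Finset (κ.ord.ToType × E))
    (hc : ∀ ξ, ∀ p ∈ c ξ, p.1 < ξ) : ∃ C, #{ξ | c ξ = C} = κ := by
  classical
  by_contra! hne
  have hlt : ∀ C, #{ξ | c ξ = C} < κ := fun C =>
    lt_of_le_of_ne ((mk_set_le _).trans_eq (by simp)) (hne C)
  have hbdd : ∀ s : Set κ.ord.ToType, #s < κ → ∃ b, ∀ ξ ∈ s, ξ < b := by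
    intro s hs
    by_contra! hcof
    have : IsCofinal s := fun b => hcof b
    have := Order.cof_le this
    rw [Ordinal.cof_toType, hκ.cof_ord] at this
    exact this.not_gt hs
  have hbound : ∀ δ : κ.ord.ToType, ∃ b, δ < b ∧ ∀ ξ, (∀ p ∈ c ξ, p.1 < δ) → ξ < b := by
    intro δ
    have hδ : #(Set.Iio δ) < κ := by simpa using mk_Iio_lt δ
    have hcard : #{C : Finset (κ.ord.ToType × E) | ∀ p ∈ C, p.1 < δ} < κ := by
      have hprod : #(Finset (Set.Iio δ × E)) < κ := by
        rcases finite_or_infinite (Set.Iio δ × E) with hfin | hinf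
        · exact (Cardinal.lt_aleph0_of_finite _).trans hκ0
        · rw [Cardinal.mk_finset_of_infinite, Cardinal.mk_prod, Cardinal.lift_id, Cardinal.lift_id]
          exact mul_lt_of_lt hκ0.le hδ ((Cardinal.mk_le_aleph0 (α := E)).trans_lt hκ0)
      refine lt_of_le_of_lt (mk_le_of_surjective
        (f := fun G : Finset (Set.Iio δ × E) =>
          (⟨G.image fun p => (p.1.1, p.2), ?_⟩ :
            {C : Finset (κ.ord.ToType × E) | ∀ p ∈ C, p.1 < δ})) ?_) hprod
      · intro p hp
        obtain ⟨q, -, rfl⟩ := Finset.mem_image.1 hp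
        exact q.1.2
      · rintro ⟨C, hC⟩
        refine ⟨C.attach.image fun p => (⟨p.1.1, hC p.1 p.2⟩, p.1.2), Subtype.ext ?_⟩
        ext p
        simp only [Finset.mem_image, Finset.mem_attach, true_and, Subtype.exists]
        constructor
        · rintro ⟨_, ⟨q, hq, rfl⟩, rfl⟩
          exact hq
        · exact fun h => ⟨_, ⟨p, h, rfl⟩, rfl⟩
    have hunion : #(⋃ C ∈ {C : Finset (κ.ord.ToType × E) | ∀ p ∈ C, p.1 < δ}, {ξ | c ξ = C}) < κ :=
      (card_biUnion_lt_iff_forall_of_isRegular hκ hcard).2 fun C _ => hlt C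
    obtain ⟨b₁, hb₁⟩ := hbdd _ hunion
    obtain ⟨b₂, hb₂⟩ := hbdd {δ} (by simpa using one_lt_aleph0.trans hκ0)
    exact ⟨max b₁ b₂, lt_max_of_lt_right (hb₂ δ rfl), fun ξ hξ =>
      lt_max_of_lt_left (hb₁ ξ (Set.mem_biUnion (x := c ξ) hξ rfl))⟩
  choose b hb1 hb2 using hbound
  obtain ⟨δ₀⟩ : Nonempty κ.ord.ToType := by
    rw [← Cardinal.mk_ne_zero_iff]
    simpa using hκ.pos.ne'
  let δ : ℕ → κ.ord.ToType := fun n => b^[n] δ₀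
  have hδ : ∀ n, δ (n + 1) = b (δ n) := fun n => Function.iterate_succ_apply' b n δ₀
  have hmono : StrictMono δ := strictMono_nat_of_lt_succ fun n => by
    rw [hδ]; exact hb1 _
  obtain ⟨β, hβ⟩ := hbdd (Set.range δ) ((Cardinal.le_aleph0_iff_set_countable.2
    (Set.countable_range δ)).trans_lt hκ0)
  -- At the supremum `s` of the `δ n`, the finite set `c s` lives below some `δ n`, so the choice of
  -- `b` forces `s < δ (n + 1)`.
  obtain ⟨s, hs, hmin⟩ := WellFounded.has_min (wellFounded_lt (α := κ.ord.ToType))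
    (upperBounds (Set.range δ)) ⟨β, fun ξ hξ => (hβ ξ hξ).le⟩
  have hex : ∀ p ∈ c s, ∃ n, p.1 < δ n := by
    intro p hp
    by_contra! h
    refine hmin p.1 ?_ (hc s p hp)
    rintro _ ⟨n, rfl⟩
    exact h n
  choose! N hN using hex
  have hlt' := hb2 (δ ((c s).sup N)) s fun p hp =>
    (hN p hp).trans_le (hmono.monotone (Finset.le_sup hp))
  rw [← hδ] at hlt'
  exact (hs ⟨_, rfl⟩).not_gt hlt'

/-! ### Independent families of functions -/

/-- The real number `0` or `1` attached to a Boolean. -/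
def boolReal (b : Bool) : ℝ := if b then 1 else 0

section
variable {X : Type u} [TopologicalSpace X] {W : Type} [LinearOrder W]

/-- The part of `H` where the functions indexed by `a` take the values prescribed by `t`. -/
def cell (H : Set X) (g : W → C(X, ℝ)) (a : Set W) (t : W → Bool) : Set X :=
  {x ∈ H | ∀ η ∈ a, g η x = boolReal (t η)}

theorem cell_nonempty_of_finset [CompactSpace X] {H : Set X} (hH : IsClosed H) {g : W → C(X, ℝ)}
    {D : Set W} {t : W → Bool} (h : ∀ F : Finset W, ↑F ⊆ D → (cell H g F t).Nonempty) :
    (cell H g D t).Nonempty := by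
  classical
  have := IsCompact.inter_iInter_nonempty (s := H) hH.isCompact
    (fun η : D => {x | g η x = boolReal (t η)})
    (fun η => isClosed_eq (g η).continuous continuous_const) (fun F => by
      obtain ⟨x, hx, hx'⟩ := h (F.image Subtype.val) (by simp)
      refine ⟨x, hx, ?_⟩
      simp only [Set.mem_iInter]
      intro η hη
      exact hx' η (by simpa using hη))
  obtain ⟨x, hx, hx'⟩ := this
  rw [Set.mem_iInter] at hx'
  exact ⟨x, hx, fun η hη => hx' ⟨η, hη⟩⟩

/-- `(a, t)` extends the finite partial function `c`. -/
def Extends (c : Finset W × (W → Bool)) (a : Set W) (t : W → Bool) : Prop :=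
  ∀ ζ ∈ c.1, ζ ∈ a ∧ t ζ = c.2 ζ

/-- `(a, t)` extends the partial function attached to each member of `a`. -/
def IsCoherent (c : W → Finset W × (W → Bool)) (a : Set W) (t : W → Bool) : Prop :=
  ∀ η ∈ a, Extends (c η) a t

/-- The value at `ξ` of the recursive construction: `g ξ` is independent, over the coherent
conditions extending `c ξ`, of the functions constructed before. -/
def IsIndependentStep (H : Set X) (f : W → (Finset W × (W → Bool)) × C(X, ℝ)) (ξ : W) : Prop :=
  (∀ ζ ∈ (f ξ).1.1, ζ < ξ) ∧
  IsCoherent (fun η => (f η).1) ((f ξ).1.1 : Finset W) (f ξ).1.2 ∧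
  ∀ (a : Finset W) (t : W → Bool), (∀ ζ ∈ a, ζ < ξ) → IsCoherent (fun η => (f η).1) a t →
    Extends (f ξ).1 a t → ∀ b : Bool,
      ∃ x ∈ cell H (fun η => (f η).2) a t, (f ξ).2 x = boolReal b

theorem IsIndependentStep.congr {H : Set X} {f f' : W → (Finset W × (W → Bool)) × C(X, ℝ)} {ξ : W}
    (h : Set.EqOn f f' (Set.Iic ξ)) (hf : IsIndependentStep H f ξ) : IsIndependentStep H f' ξ := by
  obtain ⟨h1, h2, h3⟩ := hf
  have hξ : f ξ = f' ξ := h (Set.mem_Iic.2 le_rfl)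
  rw [hξ] at h1 h2 h3
  refine ⟨h1, fun η hη => ?_, fun a t ha hc he b => ?_⟩
  · have : Extends (f η).1 _ _ := h2 η hη
    rwa [h (Set.mem_Iic.2 (h1 η hη).le)] at this
  · obtain ⟨x, ⟨hx, hx'⟩, hxb⟩ := h3 a t ha (fun η hη => by
      have : Extends (f' η).1 _ _ := hc η hη
      rwa [← h (Set.mem_Iic.2 (ha η hη).le)] at this) he b
    refine ⟨x, ⟨hx, fun η hη => ?_⟩, hxb⟩
    have : (f η).2 x = _ := hx' η hη
    rwa [h (Set.mem_Iic.2 (ha η hη).le)] at this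

/-- Conditions refer only to smaller indices, so deleting the maximum of `a` preserves coherence,
and independence at the maximum supplies the point. -/
theorem cell_nonempty_of_isIndependentStep {H : Set X} (hne : H.Nonempty)
    {f : W → (Finset W × (W → Bool)) × C(X, ℝ)} {a : Finset W} {t : W → Bool}
    (hf : ∀ η ∈ a, IsIndependentStep H f η) (hc : IsCoherent (fun η => (f η).1) a t) :
    (cell H (fun η => (f η).2) a t).Nonempty := by
  rcases a.eq_empty_or_nonempty with rfl | ha
  · obtain ⟨x, hx⟩ := hne
    exact ⟨x, hx, by simp⟩
  set m := a.max' ha with hm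
  have hma : m ∈ a := a.max'_mem ha
  have hlt : ∀ ζ ∈ a.erase m, ζ < m := fun ζ hζ =>
    lt_of_le_of_ne (a.le_max' ζ (Finset.mem_of_mem_erase hζ)) (Finset.ne_of_mem_erase hζ)
  have hext : ∀ η ∈ a, Extends (f η).1 (a.erase m : Finset W) t := by
    intro η hη ζ hζ
    obtain ⟨h1, h2⟩ := hc η hη ζ hζ
    have h3 : ζ < m := ((hf η hη).1 ζ hζ).trans_le (a.le_max' η hη)
    exact ⟨Finset.mem_coe.2 (Finset.mem_erase.2 ⟨h3.ne, h1⟩), h2⟩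
  obtain ⟨x, ⟨hx, hx'⟩, hxm⟩ := (hf m hma).2.2 (a.erase m) t hlt
    (fun η hη => hext η (Finset.mem_of_mem_erase hη)) (hext m hma) (t m)
  refine ⟨x, hx, fun η hη => ?_⟩
  by_cases h : η = m
  · rw [h]; exact hxm
  · exact hx' η (Finset.mem_coe.2 (Finset.mem_erase.2 ⟨h, hη⟩))

/-- No neighbourhood base at a point of `H` consists of sets containing one of countably many
cells given by functions with index below some `ξ`. -/
def AvoidsCells (W : Type) [LinearOrder W] (H : Set X) : Prop :=
  ∀ (g : W → C(X, ℝ)) (ξ : W) (D : ℕ → Set W) (t : ℕ → W → Bool), (∀ n, D n ⊆ Set.Iio ξ) →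
    (∀ n, (cell H g (D n) (t n)).Nonempty) → ∀ q ∈ H, ∃ U ∈ 𝓝 q, ∀ n, ¬ cell H g (D n) (t n) ⊆ U

/-- Countably many cells suffice to refine all coherent finite ones, because the cube over `Iio ξ`
is separable. A function equal to `1` at `q` and vanishing somewhere in each of these cells thus
takes the value `0` in every coherent cell. Finitely many such functions cover `H`, so one of them
is large throughout the coherent cells below some condition, which becomes the condition attached to
`ξ`. -/
theorem exists_isIndependentStep [CompactSpace X] [T2Space X] {H : Set X} (hH : IsClosed H)
    (hne : H.Nonempty) (hW : ∀ ξ : W, #(Set.Iio ξ) ≤ 𝔠) (hav : AvoidsCells W H) (ξ : W)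
    (f : W → (Finset W × (W → Bool)) × C(X, ℝ)) (hf : ∀ η < ξ, IsIndependentStep H f η) :
    ∃ e, IsIndependentStep H (Function.update f ξ e) ξ := by
  classical
  set c : W → Finset W × (W → Bool) := fun η => (f η).1 with hc
  set g : W → C(X, ℝ) := fun η => (f η).2 with hg
  have hinv : ∀ (a : Finset W) (t : W → Bool), (∀ ζ ∈ a, ζ < ξ) → IsCoherent c a t →
      (cell H g a t).Nonempty := fun a t ha hat =>
    cell_nonempty_of_isIndependentStep hne (fun η hη => hf η (ha η hη)) hat
  obtain ⟨T, hT⟩ := exists_seq_agreeing_on_finsets (hW ξ)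
  -- The largest domain usable with `T n`: finite unions of sets coherent for the same assignment
  -- are coherent.
  let D : ℕ → Set W := fun n => {η | ∃ a : Finset W, (∀ ζ ∈ a, ζ < ξ) ∧ IsCoherent c a (T n) ∧ η ∈ a}
  have hDne : ∀ n, (cell H g (D n) (T n)).Nonempty := by
    intro n
    refine cell_nonempty_of_finset hH fun F hF => ?_
    choose! s hs1 hs2 hs3 using hF
    obtain ⟨x, hx, hx'⟩ := hinv (F.biUnion s) (T n) (fun ζ hζ => by
      obtain ⟨η, hη, hζη⟩ := Finset.mem_biUnion.1 hζ
      exact hs1 hη ζ hζη) (fun ζ hζ θ hθ => by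
      obtain ⟨η, hη, hζη⟩ := Finset.mem_biUnion.1 hζ
      obtain ⟨h1, h2⟩ := hs2 hη ζ hζη θ hθ
      exact ⟨Finset.mem_coe.2 (Finset.mem_biUnion.2 ⟨η, hη, h1⟩), h2⟩)
    exact ⟨x, hx, fun η hη => hx' η (Finset.mem_coe.2 (Finset.mem_biUnion.2 ⟨η, hη, hs3 hη⟩))⟩
  have hk : ∀ q ∈ H, ∃ k : C(X, ℝ), k q = 1 ∧ ∀ n, ∃ x ∈ cell H g (D n) (T n), k x = 0 := by
    intro q hq
    obtain ⟨U, hU, hUn⟩ := hav g ξ D T (fun n η ⟨a, ha, _, hη⟩ => ha η hη) hDne q hq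
    obtain ⟨k, hk0, hk1, -⟩ := exists_continuous_zero_one_of_isClosed
      (s := (interior U)ᶜ) (t := {q}) isOpen_interior.isClosed_compl isClosed_singleton
      (by simpa using mem_interior_iff_mem_nhds.2 hU)
    refine ⟨k, hk1 rfl, fun n => ?_⟩
    obtain ⟨x, hx, hxU⟩ := Set.not_subset.1 (hUn n)
    exact ⟨x, hx, hk0 fun hxi => hxU (interior_subset hxi)⟩
  choose! k hk1 hk0 using hk
  obtain ⟨Q, hQH, hQ⟩ := hH.isCompact.elim_nhds_subcover (fun q => {x | 1 / 2 < k q x})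
    fun q hq => (isOpen_lt continuous_const (k q).continuous).mem_nhds (by
      show 1 / 2 < k q q
      rw [hk1 q hq]; norm_num)
  -- some function of the cover takes large values densely below some condition
  obtain ⟨q, hqQ, a₀, t₀, ha₀, hat₀, hdense⟩ : ∃ q ∈ Q, ∃ (a₀ : Finset W) (t₀ : W → Bool),
      (∀ ζ ∈ a₀, ζ < ξ) ∧ IsCoherent c a₀ t₀ ∧ ∀ (a : Finset W) (t : W → Bool),
        (∀ ζ ∈ a, ζ < ξ) → IsCoherent c a t → Extends (a₀, t₀) a t →
          ∃ x ∈ cell H g a t, 1 / 2 < k q x := by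
    by_contra! hcon
    have key : ∀ R ⊆ Q, ∃ (a : Finset W) (t : W → Bool), (∀ ζ ∈ a, ζ < ξ) ∧ IsCoherent c a t ∧
        ∀ q ∈ R, ∀ x ∈ cell H g a t, k q x ≤ 1 / 2 := by
      intro R
      induction R using Finset.induction_on with
      | empty => exact fun _ => ⟨∅, fun _ => false, by simp, fun η hη => by simp at hη, by simp⟩
      | insert q R _ ih =>
        intro hR
        obtain ⟨a, t, ha, hat, hle⟩ := ih fun r hr => hR (Finset.mem_insert_of_mem hr)
        obtain ⟨a', t', ha', hat', hext, hle'⟩ :=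
          hcon q (hR (Finset.mem_insert_self q R)) a t ha hat
        refine ⟨a', t', ha', hat', fun r hr x hx => ?_⟩
        rcases Finset.mem_insert.1 hr with rfl | hr
        · exact hle' x hx
        · refine hle r hr x ⟨hx.1, fun η hη => ?_⟩
          obtain ⟨h1, h2⟩ := hext η hη
          rw [hx.2 η h1, h2]
    obtain ⟨a, t, ha, hat, hle⟩ := key Q subset_rfl
    obtain ⟨x, hx⟩ := hinv a t ha hat
    obtain ⟨q, hq, hqx⟩ := Set.mem_iUnion₂.1 (hQ hx.1)
    exact (hle q hq x hx).not_gt hqx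
  -- Rescaling and truncating turns values above `1/2` into exactly `1` and keeps the zeros.
  let k' : C(X, ℝ) := ⟨fun x => min (2 * k q x) 1, by fun_prop⟩
  have hu : ∀ η < ξ, Function.update f ξ ((a₀, t₀), k') η = f η := fun η hη =>
    Function.update_of_ne hη.ne _ _
  have hcoh : ∀ (a : Finset W) (t : W → Bool), (∀ ζ ∈ a, ζ < ξ) →
      (IsCoherent (fun η => (Function.update f ξ ((a₀, t₀), k') η).1) a t ↔ IsCoherent c a t) := by
    intro a t ha
    refine forall₂_congr fun η hη => ?_
    beta_reduce
    rw [hu η (ha η hη)]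
  refine ⟨((a₀, t₀), k'), ?_⟩
  unfold IsIndependentStep
  simp only [Function.update_self]
  refine ⟨ha₀, (hcoh a₀ t₀ ha₀).2 hat₀, fun a t ha hat hext b => ?_⟩
  rw [hcoh a t ha] at hat
  have hcell : ∀ x, x ∈ cell H g a t →
      x ∈ cell H (fun η => (Function.update f ξ ((a₀, t₀), k') η).2) a t := by
    rintro x ⟨hx, hx'⟩
    refine ⟨hx, fun η hη => ?_⟩
    beta_reduce
    rw [hu η (ha η hη)]
    exact hx' η hη
  cases b
  -- As `T n` agrees with `t` on `a`, `a` lies in `D n` and the cell of `D n` lies in that of `a`.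
  · obtain ⟨n, hn⟩ := hT a ha t
    obtain ⟨x, ⟨hx, hx'⟩, hx0⟩ := hk0 q (hQH q hqQ) n
    refine ⟨x, hcell x ⟨hx, fun η hη => ?_⟩, by simp [k', hx0, boolReal]⟩
    rw [← hn η hη]
    refine hx' η ⟨a, ha, fun θ hθ ζ hζ => ?_, hη⟩
    obtain ⟨h1, h2⟩ := hat θ hθ ζ hζ
    exact ⟨h1, by rw [hn ζ h1, h2]⟩
  · obtain ⟨x, hx, hx1⟩ := hdense a t ha hat hext
    refine ⟨x, hcell x hx, ?_⟩
    simp only [k', boolReal, ContinuousMap.coe_mk, if_true]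
    exact min_eq_right (by linarith)

end

/-! ### Maps onto Tychonoff cubes -/

/-- Pressing down the attached conditions gives `κ` indices sharing one condition. Any finite set of
them, joined with the domain of that condition, is coherent, so all values on it are realised;
compactness passes to all of `S`. -/
theorem exists_independent_family {X : Type u} [TopologicalSpace X] [CompactSpace X] [T2Space X]
    {H : Set X} (hH : IsClosed H) (hne : H.Nonempty) {κ : Cardinal.{0}} (hκ : κ.IsRegular)
    (hκ0 : ℵ₀ < κ) (hW : ∀ ξ : κ.ord.ToType, #(Set.Iio ξ) ≤ 𝔠) (hav : AvoidsCells κ.ord.ToType H) :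
    ∃ (S : Set κ.ord.ToType) (g : κ.ord.ToType → C(X, ℝ)), #S = κ ∧
      ∀ t : κ.ord.ToType → Bool, ∃ x, ∀ η ∈ S, g η x = boolReal (t η) := by
  classical
  obtain ⟨f, hf⟩ := exists_forall_of_wellFounded_step
    (P := fun ξ f => IsIndependentStep (X := X) (W := κ.ord.ToType) H f ξ)
    (fun ξ f f' h => IsIndependentStep.congr h) (exists_isIndependentStep hH hne hW hav)
  obtain ⟨C, hC⟩ := exists_mk_fiber_eq_of_regressive hκ hκ0
    -- Only the graph over the finite domain is pressed down, since values of the assignment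
    -- elsewhere are irrelevant.
    (fun ξ => (f ξ).1.1.image fun ζ => (ζ, (f ξ).1.2 ζ)) (by
      intro ξ p hp
      obtain ⟨ζ, hζ, rfl⟩ := Finset.mem_image.1 hp
      exact (hf ξ).1 ζ hζ)
  set S := {ξ | ((f ξ).1.1.image fun ζ => (ζ, (f ξ).1.2 ζ)) = C} with hS
  obtain ⟨ξ₀, hξ₀⟩ : S.Nonempty := by
    rw [← Set.nonempty_coe_sort, ← Cardinal.mk_ne_zero_iff, hC]
    exact hκ.pos.ne'
  have hext : ∀ ξ ∈ S, ∀ ζ, (ζ ∈ (f ξ).1.1 ↔ ζ ∈ (f ξ₀).1.1) ∧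
      (ζ ∈ (f ξ).1.1 → (f ξ).1.2 ζ = (f ξ₀).1.2 ζ) := by
    have aux : ∀ ξ ∈ S, ∀ ξ' ∈ S, ∀ ζ ∈ (f ξ).1.1, ζ ∈ (f ξ').1.1 ∧
        (f ξ').1.2 ζ = (f ξ).1.2 ζ := by
      intro ξ hξ ξ' hξ' ζ hζ
      have h1 : (ζ, (f ξ).1.2 ζ) ∈ C := by
        rw [← show _ = C from hξ]
        exact Finset.mem_image_of_mem _ hζ
      rw [← show _ = C from hξ'] at h1
      obtain ⟨ζ', hζ', h2⟩ := Finset.mem_image.1 h1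
      obtain ⟨rfl, h3⟩ := Prod.ext_iff.1 h2
      exact ⟨hζ', h3⟩
    exact fun ξ hξ ζ => ⟨⟨fun h => (aux ξ hξ ξ₀ hξ₀ ζ h).1, fun h => (aux ξ₀ hξ₀ ξ hξ ζ h).1⟩,
      fun h => ((aux ξ hξ ξ₀ hξ₀ ζ h).2).symm⟩
  refine ⟨S, fun η => (f η).2, hC, fun t => ?_⟩
  suffices h : (cell H (fun η => (f η).2) S t).Nonempty by
    obtain ⟨x, -, hx⟩ := h
    exact ⟨x, hx⟩
  refine cell_nonempty_of_finset hH fun F hF => ?_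
  let t' : κ.ord.ToType → Bool := fun η => if η ∈ (f ξ₀).1.1 then (f ξ₀).1.2 η else t η
  have hcoh : IsCoherent (fun η => (f η).1) ((f ξ₀).1.1 ∪ F : Finset κ.ord.ToType) t' := by
    intro η hη ζ hζ
    have hζ0 : ζ ∈ (f ξ₀).1.1 ∧ (f ξ₀).1.2 ζ = (f η).1.2 ζ := by
      rcases Finset.mem_union.1 hη with h | h
      · exact (hf ξ₀).2.1 η h ζ hζ
      · exact ⟨((hext η (hF h) ζ).1).1 hζ, ((hext η (hF h) ζ).2 hζ).symm⟩
    refine ⟨Finset.mem_coe.2 (Finset.mem_union_left _ hζ0.1), ?_⟩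
    simp only [t', if_pos hζ0.1, hζ0.2]
  obtain ⟨x, hx, hx'⟩ := cell_nonempty_of_isIndependentStep hne (fun η _ => hf η) hcoh
  refine ⟨x, hx, fun η hη => ?_⟩
  rw [hx' η (Finset.mem_coe.2 (Finset.mem_union_right _ hη))]
  -- An index of `S` in the common domain would be smaller than itself, so `t'` does not override
  -- `t` on `F`.
  have hnot : η ∉ (f ξ₀).1.1 := fun h =>
    (lt_irrefl η) ((hf η).1 η (((hext η (hF hη) η).1).2 h))
  simp only [t', if_neg hnot]

/-- The real number in the unit interval with given binary digits, the digits being clipped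
values of real functions. -/
noncomputable def binarySum (d : ℕ → ℝ) : ℝ :=
  ∑' n, max 0 (min (d n) 1) * ((2 : ℝ) ^ (n + 1))⁻¹

theorem continuous_binarySum {X : Type u} [TopologicalSpace X] (g : ℕ → C(X, ℝ)) :
    Continuous fun x => binarySum fun n => g n x := by
  unfold binarySum
  refine continuous_tsum (u := fun n : ℕ => (1 / 2 : ℝ) ^ n) (fun n => by fun_prop)
    summable_geometric_two fun n x => ?_
  have h1 : 0 ≤ max 0 (min (g n x) 1) := le_max_left _ _
  have h2 : max 0 (min (g n x) 1) ≤ 1 := max_le zero_le_one (min_le_right _ _)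
  rw [Real.norm_of_nonneg (by positivity), one_div, inv_pow]
  calc max 0 (min (g n x) 1) * ((2 : ℝ) ^ (n + 1))⁻¹ ≤ 1 * ((2 : ℝ) ^ n)⁻¹ := by
        gcongr
        · norm_num
        · omega
    _ = _ := one_mul _

theorem exists_binarySum_boolReal_eq (r : unitInterval) :
    ∃ t : ℕ → Bool, binarySum (fun n => boolReal (t n)) = r := by
  obtain ⟨d, -, hd⟩ := Real.ofDigits_SurjOn (b := 2) (by norm_num) r.2
  refine ⟨fun n => decide (d n = 1), ?_⟩
  rw [← hd]
  unfold binarySum Real.ofDigits Real.ofDigitsTerm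
  refine tsum_congr fun n => ?_
  have h : ∀ i : Fin 2, max 0 (min (boolReal (decide (i = 1))) 1) = ((i : ℕ) : ℝ) := by
    intro i
    fin_cases i <;> simp [boolReal]
  simp only [h, Nat.cast_ofNat]

theorem exists_surjective_cube_of_independent {X : Type u} [TopologicalSpace X] {W : Type}
    {S : Set W} {g : W → C(X, ℝ)} (hS : #S = #W) [Infinite W]
    (hg : ∀ t : W → Bool, ∃ x, ∀ η ∈ S, g η x = boolReal (t η)) :
    ∃ f : X → (W → unitInterval), Continuous f ∧ Function.Surjective f := by
  classical
  -- Each coordinate of the cube gets its own countable block of functions, used as binary digits.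
  obtain ⟨e⟩ : Nonempty (W × ℕ ≃ S) := Cardinal.eq.1 (by simp [hS])
  refine ⟨fun x w => Set.projIcc 0 1 zero_le_one (binarySum fun n => g (e (w, n)) x),
    continuous_pi fun w => continuous_projIcc.comp (continuous_binarySum fun n => g (e (w, n))),
    fun r => ?_⟩
  choose t ht using fun w => exists_binarySum_boolReal_eq (r w)
  obtain ⟨x, hx⟩ := hg fun η => if h : η ∈ S then t (e.symm ⟨η, h⟩).1 (e.symm ⟨η, h⟩).2 else false
  refine ⟨x, funext fun w => ?_⟩
  have : (fun n => g (e (w, n)) x) = fun n => boolReal (t w n) := by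
    funext n
    rw [hx _ (e (w, n)).2]
    simp
  beta_reduce
  rw [this, ht w]
  exact Set.projIcc_val _ _

theorem isRegular_aleph_two : (ℵ_ 2 : Cardinal.{u}).IsRegular :=
  aleph_two_eq_succ ▸ isRegular_succ (aleph0_le_aleph 1)

theorem mk_Iio_le_aleph_one (ξ : (ℵ_ 2 : Cardinal.{u}).ord.ToType) : #(Set.Iio ξ) ≤ ℵ₁ := by
  have h : #(Set.Iio ξ) < ℵ_ 2 := by simpa using mk_Iio_lt ξ
  exact Order.lt_succ_iff.1 (h.trans_eq aleph_two_eq_succ)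

/-- A compact space with a radially closed set that contains the closures of its countable
subsets but is not closed maps onto the Tychonoff cube of weight `ℵ₂`. -/
theorem exists_surjective_cube_aleph_two {X : Type u} [TopologicalSpace X] [CompactSpace X]
    [T2Space X] {A : Set X} (hA : IsRadiallyClosed A)
    (hω : ∀ C ⊆ A, C.Countable → closure C ⊆ A) (hcl : ¬ IsClosed A) :
    ∃ f : X → ((ℵ_ 2 : Cardinal.{0}).ord.ToType → unitInterval),
      Continuous f ∧ Function.Surjective f := by
  obtain ⟨G, hne, hdisj, hd⟩ := exists_isZeroDense hcl
  obtain ⟨hθ, hcof⟩ := hd.aleph0_lt_cof hω hne hdisj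
  have hav : AvoidsCells (ℵ_ 2 : Cardinal.{0}).ord.ToType (closure A ∩ commonZeros G) := by
    intro g ξ D t hD hcell q hq
    by_contra! hcon
    refine hdisj ⟨q, ?_, hq.2⟩
    -- A cell is itself a zero set, with at most `ℵ₁ ≤ θ` functions added to `G`.
    have hzeros : ∀ n, closure A ∩ commonZeros (G ∪ (fun η => g η - ContinuousMap.const X
        (boolReal (t n η))) '' D n) = cell (closure A ∩ commonZeros G) g (D n) (t n) := by
      intro n
      ext x
      constructor
      · rintro ⟨h1, h2⟩
        refine ⟨⟨h1, fun h hh => h2 h (Or.inl hh)⟩, fun η hη => ?_⟩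
        have := h2 _ (Or.inr ⟨η, hη, rfl⟩)
        simpa [sub_eq_zero] using this
      · rintro ⟨⟨h1, h2⟩, h3⟩
        refine ⟨h1, ?_⟩
        rintro h (hh | ⟨η, hη, rfl⟩)
        · exact h2 h hh
        · simpa [sub_eq_zero] using h3 η hη
    refine hd.mem_of_forall_nhds_commonZeros hA hω hθ.le hcof
      (fun n => G ∪ (fun η => g η - ContinuousMap.const X (boolReal (t n η))) '' D n)
      (fun n => ?_) (fun n => ?_) fun U hU => ?_
    · refine (mk_union_le _ _).trans (add_le_of_le hθ.le le_rfl ?_)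
      have h1 := mk_image_le_lift.{0, u}
        (f := fun η => g η - ContinuousMap.const X (boolReal (t n η))) (s := D n)
      have h2 : #(D n) ≤ ℵ₁ := (mk_le_mk_of_subset (hD n)).trans (mk_Iio_le_aleph_one ξ)
      have h3 : Cardinal.lift.{u} #(D n) ≤ ℵ₁ := by simpa using Cardinal.lift_le.{u}.2 h2
      have h4 : (ℵ₁ : Cardinal.{u}) ≤ #G := by
        rw [← Cardinal.succ_aleph0]
        exact Order.succ_le_of_lt hθ
      simpa using h1.trans (h3.trans h4)
    · rw [hzeros]; exact hcell n
    · obtain ⟨n, hn⟩ := hcon U hU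
      exact ⟨n, by rwa [hzeros]⟩
  have hlt : (ℵ₀ : Cardinal.{0}) < ℵ_ 2 := by
    rw [← Cardinal.aleph_zero]
    exact Cardinal.aleph_lt_aleph.2 (by norm_num)
  obtain ⟨S, g, hS, hg⟩ := exists_independent_family (isClosed_closure.inter
    (isClosed_commonZeros G)) hne isRegular_aleph_two hlt
    (fun ξ => (mk_Iio_le_aleph_one ξ).trans aleph_one_le_continuum) hav
  have : Infinite (ℵ_ 2 : Cardinal.{0}).ord.ToType := by
    rw [Cardinal.infinite_iff]
    simp
  exact exists_surjective_cube_of_independent (by simpa using hS) hg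

/-- A compact pseudoradial space does not map onto a Tychonoff cube whose Cantor subcube is not
pseudoradial. -/
theorem IsPseudoradial.not_surjective_cube {X : Type u} [TopologicalSpace X] [CompactSpace X]
    (hX : IsPseudoradial X) {I : Type} (hI : ¬ IsPseudoradial (I → Bool))
    {f : X → (I → unitInterval)} (hf : Continuous f) : ¬ Function.Surjective f := by
  intro hsurj
  rw [isPseudoradial_iff] at hI hX
  push Not at hI
  obtain ⟨B, hB, hBcl⟩ := hI
  let e : (I → Bool) → (I → unitInterval) := fun z i => if z i then 1 else 0
  have he : Topology.IsClosedEmbedding e := by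
    refine Continuous.isClosedEmbedding ?_ fun z z' h => funext fun i => ?_
    · exact continuous_pi fun i => (continuous_of_discreteTopology
        (f := fun b : Bool => if b then (1 : unitInterval) else 0)).comp (continuous_apply i)
    · have := congrFun h i
      cases hz : z i <;> cases hz' : z' i <;> simp_all [e]
  have hrad : IsRadiallyClosed (f ⁻¹' (e '' B)) := by
    intro κ hκ x hx p hp
    choose y hyB hy using hx
    have hconv : ∀ U ∈ 𝓝 (f p), #{α // f (x α) ∉ U} < κ := fun U hU => hp _ (hf.continuousAt hU)
    -- The Cantor subcube is closed, so the image of the limit stays in it and convergence can be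
    -- tested there.
    have hmem : f p ∈ Set.range e := by
      by_contra hnot
      refine (hconv _ (he.isClosed_range.isOpen_compl.mem_nhds hnot)).not_ge ?_
      have : ∀ α, f (x α) ∉ (Set.range e)ᶜ := fun α h => h ⟨y α, hy α⟩
      exact (mk_ord_toType κ).ge.trans (mk_le_of_injective (f := fun α => ⟨α, this α⟩)
        fun _ _ h => congrArg Subtype.val h)
    obtain ⟨b, hb⟩ := hmem
    refine ⟨b, hB.mem_of_forall_mk_lt_lift hκ y hyB fun U hU => ?_, hb⟩
    rw [he.isInducing.nhds_eq_comap, Filter.mem_comap] at hU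
    obtain ⟨V, hV, hVU⟩ := hU
    rw [hb] at hV
    refine (Cardinal.mk_subtype_mono fun α hα hV' => hα (hVU ?_)).trans_lt (hconv V hV)
    rwa [Set.mem_preimage, hy α]
  have hclosed : IsClosed (e '' B) := by
    rw [← Set.image_preimage_eq (e '' B) hsurj]
    exact hf.isClosedMap _ (hX _ hrad)
  exact hBcl (by
    rw [← Set.preimage_image_eq B he.injective]
    exact hclosed.preimage he.continuous)

theorem exists_surjective_cube_of_le {X : Type u} [TopologicalSpace X] {κ μ : Cardinal.{0}}
    (h : κ ≤ μ) (hX : ∃ f : X → (μ.ord.ToType → unitInterval),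
      Continuous f ∧ Function.Surjective f) :
    ∃ f : X → (κ.ord.ToType → unitInterval), Continuous f ∧ Function.Surjective f := by
  obtain ⟨f, hf, hsurj⟩ := hX
  obtain ⟨j⟩ : #κ.ord.ToType ≤ #μ.ord.ToType := by simpa using h
  refine ⟨fun x i => f x (j i), continuous_pi fun i => (continuous_apply (j i)).comp hf,
    fun r => ?_⟩
  obtain ⟨x, hx⟩ := hsurj (Function.extend j r 0)
  exact ⟨x, funext fun i => by beta_reduce; rw [hx]; exact j.injective.extend_apply r 0 i⟩

theorem IsWeaklyPseudoradial.closure_subset {X : Type u} [TopologicalSpace X]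
    (hX : IsWeaklyPseudoradial X) {A : Set X} (hA : IsRadiallyClosed A) {C : Set X} (hCA : C ⊆ A)
    (hC : C.Countable) : closure C ⊆ A :=
  (closure_minimal (isLeast_radialClosure C).1.1 (hX C hC)).trans
    ((isLeast_radialClosure C).2 ⟨hCA, hA⟩)

theorem mainTheorem2 :
    (pseudoradialNumber ≤ ℵ_ 2 →
      ∀ (X : Type u) [TopologicalSpace X] [CompactSpace X] [T2Space X],
        IsWeaklyPseudoradial X →
          (IsPseudoradial X ↔
            ¬ ∃ f : X → (pseudoradialNumber.ord.ToType → unitInterval),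
              Continuous f ∧ Function.Surjective f)) ∧
    (splittingNumber ≤ ℵ_ 2 → pseudoradialNumber = splittingNumber) := by
  refine ⟨fun h X _ _ _ hX => ⟨?_, fun hno => ?_⟩, pseudoradialNumber_eq_splittingNumber⟩
  · rintro hps ⟨f, hf, hsurj⟩
    exact hps.not_surjective_cube not_isPseudoradial_cube_pseudoradialNumber hf hsurj
  · rw [isPseudoradial_iff]
    intro A hA
    by_contra hcl
    exact hno (exists_surjective_cube_of_le h (exists_surjective_cube_aleph_two hA
      (fun C hCA hC => hX.closure_subset hA hCA hC) hcl))
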